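/- A permutation of $\{1,\dots,n\}$ ($n\ge 0$) is seen as the word $\sigma=\sigma_1\cdots\sigma_n$. A word $u$ is a \emph{pattern} of $\sigma$ if there are indices $i_1<\dots<i_k$ such that $u$ is the image of the subsequence $\sigma_{i_1}\cdots\sigma_{i_k}$ under the increasing bijection from $\{\sigma_{i_1},\dots,\sigma_{i_k}\}$ onto $\{1,\dots,k\}$. A \emph{one-stack sortable permutation} is a permutation that does not have the pattern $231$. A \emph{greatest common pattern} of $\sigma$ and $\tau$ is a word of maximal length among the words that are patterns of both $\sigma$ and $\tau$. Finding a greatest common pattern of two one-stack sortable permutations is polynomial: there are a single deterministic algorithm and a polynomial $p$ such that, for all one-stack sortable permutations $\sigma$ and $\tau$ (of possibly different lengths $|\sigma|$ and $|\tau|$), the algorithm, given $\sigma$ and $\tau$, halts after at most $p(|\sigma|+|\tau|)$ steps and outputs a greatest common pattern of $\sigma$ and $\tau$. (Steps are counted on a random access machine with unit cost whose arithmetic is addition and truncated subtraction of natural numbers.) -/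

import Mathlib

/-! ### Permutations as words, patterns -/

/-- The word `w` is a permutation of `{1, …, n}` written in one-line notation, `n = w.length`. -/
def IsPermWord (w : List ℕ) : Prop :=
  List.Perm w (List.range' 1 w.length)

/-- The normalization of a word with distinct letters: every letter is replaced by its rank among
the letters of the word, that is, by its image under the increasing bijection from the set of
letters onto `{1, …, k}`. -/
def normalizeWord (w : List ℕ) : List ℕ :=
  w.map fun a => w.countP fun b => decide (b ≤ a)

/-- `u` is a pattern of `w`: it is the normalization of a (not necessarily contiguous)
subsequence of `w`. -/
def IsPattern (u w : List ℕ) : Prop :=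
  ∃ s : List ℕ, List.Sublist s w ∧ normalizeWord s = u

/-- `w` is a permutation that avoids the pattern `231` (a one-stack sortable permutation). -/
def IsPerm231Avoiding (w : List ℕ) : Prop :=
  IsPermWord w ∧ ¬ IsPattern [2, 3, 1] w

/-- `u` is a greatest (longest) common pattern of `v` and `w`. -/
def IsGreatestCommonPattern (u v w : List ℕ) : Prop :=
  IsPattern u v ∧ IsPattern u w ∧
    ∀ x : List ℕ, IsPattern x v → IsPattern x w → x.length ≤ u.length

/-! ### Random access machines with unit cost

The registers and the memory cells hold natural numbers. The only arithmetic is addition and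
truncated subtraction (no multiplication, division or shifts), so that polynomial time on this
machine is polynomial time on a Turing machine. -/

namespace RAM

/-- The instructions; `R` denotes the registers and `M` the memory. -/
inductive Instr : Type where
  /-- `R r := c` -/
  | const (r c : ℕ) : Instr
  /-- `R r := R a + R b` -/
  | add (r a b : ℕ) : Instr
  /-- `R r := R a - R b` if this is nonnegative, and `0` otherwise -/
  | sub (r a b : ℕ) : Instr
  /-- `R r := M (R a)` -/
  | load (r a : ℕ) : Instr
  /-- `M (R a) := R b` -/
  | store (a b : ℕ) : Instr
  /-- if `R r = 0`, continue at instruction number `l`, else at the next instruction -/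
  | jumpZero (r l : ℕ) : Instr

/-- A program is a finite list of instructions, numbered from `0`. -/
abbrev Program : Type := List Instr

/-- A configuration: the number of the next instruction, the registers, the memory. -/
structure Config : Type where
  pc : ℕ
  reg : ℕ → ℕ
  mem : ℕ → ℕ

/-- The effect of one instruction. -/
def exec (c : Config) : Instr → Config
  | .const r k => ⟨c.pc + 1, Function.update c.reg r k, c.mem⟩
  | .add r a b => ⟨c.pc + 1, Function.update c.reg r (c.reg a + c.reg b), c.mem⟩
  | .sub r a b => ⟨c.pc + 1, Function.update c.reg r (c.reg a - c.reg b), c.mem⟩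
  | .load r a => ⟨c.pc + 1, Function.update c.reg r (c.mem (c.reg a)), c.mem⟩
  | .store a b => ⟨c.pc + 1, c.reg, Function.update c.mem (c.reg a) (c.reg b)⟩
  | .jumpZero r l => ⟨if c.reg r = 0 then l else c.pc + 1, c.reg, c.mem⟩

/-- One step of the program `P`. The machine halts (`none`) when there is no instruction with the
number `c.pc`. -/
def step (P : Program) (c : Config) : Option Config :=
  (P[c.pc]?).map (exec c)

/-- `HaltsIn P t c d`: started in the configuration `c`, the program `P` executes exactly `t`
instructions and halts in the configuration `d`. -/
inductive HaltsIn (P : Program) : ℕ → Config → Config → Prop where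
  | done (c : Config) (h : step P c = none) : HaltsIn P 0 c c
  | next (t : ℕ) (c c' d : Config) (h : step P c = some c') (hd : HaltsIn P t c' d) :
      HaltsIn P (t + 1) c d

/-- The initial configuration: the input is written in the memory cells `0, 1, 2, …`, and all
other cells and all registers are `0`. -/
def init (input : List ℕ) : Config :=
  ⟨0, fun _ => 0, fun i => input.getD i 0⟩

/-- The word that a halting configuration outputs: cell `0` holds its length, and the next cells
hold its letters. -/
def output (c : Config) : List ℕ :=
  (List.range (c.mem 0)).map fun i => c.mem (i + 1)

/-- The search problem "given an instance `a` that satisfies `valid a`, find a word `u` with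
`sol a u`" is solvable in polynomial time: one program solves all valid instances, with a number
of steps bounded by one polynomial in the size of the instance. -/
def SolvableInPolyTime {α : Type} (encode : α → List ℕ) (size : α → ℕ) (valid : α → Prop)
    (sol : α → List ℕ → Prop) : Prop :=
  ∃ (P : Program) (p : Polynomial ℕ), ∀ a : α, valid a →
    ∃ (t : ℕ) (d : Config), t ≤ p.eval (size a) ∧ HaltsIn P t (init (encode a)) d ∧
      sol a (output d)

end RAM

/-- The input for a pair of words: each word is preceded by its length. -/
def encodeWordPair (x : List ℕ × List ℕ) : List ℕ :=
  (x.1.length :: x.1) ++ (x.2.length :: x.2)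

/-!
In a word that avoids `231`, the letters that follow the first letter `a` are first those smaller
than `a`, then those greater than `a` (`Avoids231.lettersBelow_append_lettersFrom`). Consider a
common pattern of two such words `a w` and `b v`, given by a subsequence of each. Either one of
the two first letters is not used, or both are; in the latter case `a` corresponds to `b`, hence
letters smaller than `a` to letters smaller than `b`, and letters greater than `a` to letters
greater than `b`. Conversely, common patterns of the smaller and of the greater letters can be put
together, together with `a` and `b`. This gives the recursion `commonSubword`, which is correct by
`length_le_commonSubword` and `exists_concordant_commonSubword`.

The words that occur in this recursion are segments of the given words, since the smaller and the
greater letters are contiguous (`commonSubword_segment`). So there are only polynomially many of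
them, and dynamic programming applies. The table has one entry for each pair of segments, and the
address of an entry is its number in an order in which each entry depends only on earlier ones.
The correctness of the table is therefore a single invariant, `RAM.TableFilled`: all cells below
some address are correct.

To get a program for the random access machine, a small structured language `RAM.Cmd` is compiled
(`RAM.Cmd.executes_compile`). All its loops have the same length `N`, so that a polynomial in `N`
that bounds the number of steps can be read off from the syntax (`RAM.Cmd.time`), and the only
thing to prove about a particular program is its effect on the memory.
-/

/-! ### The recursion for greatest common patterns -/

/-- The subsequence of the letters smaller than `a`. -/
def lettersBelow (a : ℕ) (w : List ℕ) : List ℕ := w.filter (· < a)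

/-- The subsequence of the letters that are at least `a`. -/
def lettersFrom (a : ℕ) (w : List ℕ) : List ℕ := w.filter (a ≤ ·)

theorem lettersBelow_sublist (a : ℕ) (w : List ℕ) : List.Sublist (lettersBelow a w) w :=
  List.filter_sublist

theorem lettersFrom_sublist (a : ℕ) (w : List ℕ) : List.Sublist (lettersFrom a w) w :=
  List.filter_sublist

/-- A longest one of three words. -/
def longestOfThree (x y z : List ℕ) : List ℕ :=
  if y.length ≤ x.length ∧ z.length ≤ x.length then x
  else if z.length ≤ y.length then y else z

theorem length_longestOfThree (x y z : List ℕ) :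
    (longestOfThree x y z).length = max x.length (max y.length z.length) := by
  unfold longestOfThree
  split_ifs <;> omega

theorem longestOfThree_cases (x y z : List ℕ) :
    longestOfThree x y z = x ∨ longestOfThree x y z = y ∨ longestOfThree x y z = z := by
  unfold longestOfThree
  split_ifs <;> simp

/-- The recursion that computes a greatest common pattern of two words that avoid `231`, as a
subsequence of the first word. The first letters `a` and `b` are either matched, and then the
smaller letters are matched with the smaller ones and the greater letters with the greater ones,
or one of the two is dropped. -/
def commonSubword : List ℕ → List ℕ → List ℕ
  | [], _ => []
  | _ :: _, [] => []
  | a :: w, b :: v =>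
    longestOfThree
      (a :: (commonSubword (lettersBelow a w) (lettersBelow b v) ++
        commonSubword (lettersFrom a w) (lettersFrom b v)))
      (commonSubword w (b :: v)) (commonSubword (a :: w) v)
  termination_by w v => w.length + v.length
  decreasing_by
    · have := (lettersBelow_sublist a w).length_le
      have := (lettersBelow_sublist b v).length_le
      simp only [List.length_cons]
      omega
    · have := (lettersFrom_sublist a w).length_le
      have := (lettersFrom_sublist b v).length_le
      simp only [List.length_cons]
      omega
    · simp
    · simp

theorem commonSubword_nil_left (v : List ℕ) : commonSubword [] v = [] := by
  rw [commonSubword]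

theorem commonSubword_nil_right (w : List ℕ) : commonSubword w [] = [] := by
  cases w <;> rw [commonSubword]

/-- A list of pairs is *concordant* if its two coordinate words are order isomorphic: the letters
at any two places compare in the same way in both words. -/
def Concordant (z : List (ℕ × ℕ)) : Prop :=
  z.Pairwise fun p q => (q.1 < p.1 ↔ q.2 < p.2)

/-- The recursion is optimal for all words: if both first letters are used, then concordance
separates the other pairs into smaller and greater ones. -/
theorem length_le_commonSubword (w v : List ℕ) (z : List (ℕ × ℕ)) (hz : Concordant z)
    (hw : List.Sublist (z.map Prod.fst) w) (hv : List.Sublist (z.map Prod.snd) v) :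
    z.length ≤ (commonSubword w v).length := by
  induction w, v using commonSubword.induct generalizing z with
  | case1 v => simpa [commonSubword] using hw.length_le
  | case2 a w => simpa [commonSubword] using hv.length_le
  | case3 a w b v ih3 ih4 ih1 ih2 =>
    have key : z.length ≤ (commonSubword w (b :: v)).length ∨
        z.length ≤ (commonSubword (a :: w) v).length ∨
        z.length ≤ 1 + (commonSubword (lettersBelow a w) (lettersBelow b v)).length +
          (commonSubword (lettersFrom a w) (lettersFrom b v)).length := by
      cases z with
      | nil => simp
      | cons p z =>
        rw [List.map_cons] at hw hv
        by_cases h1 : List.Sublist (p.1 :: z.map Prod.fst) w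
        · exact Or.inl (ih1 (p :: z) hz h1 hv)
        by_cases h2 : List.Sublist (p.2 :: z.map Prod.snd) v
        · exact Or.inr (Or.inl (ih2 (p :: z) hz hw h2))
        right; right
        cases hw with
        | cons _ h => exact absurd h h1
        | cons_cons _ hw =>
        cases hv with
        | cons _ h => exact absurd h h2
        | cons_cons _ hv =>
        obtain ⟨a, b⟩ := p
        obtain ⟨hab, hz⟩ := List.pairwise_cons.1 hz
        have hlow := ih3 (z.filter fun q => q.1 < a) (hz.filter _)
          (by
            simpa [lettersBelow, lettersFrom, List.filter_map, Function.comp_def]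
              using hw.filter (· < a))
          (by
            have := hv.filter (· < b)
            rw [List.filter_map] at this
            dsimp only [lettersBelow, lettersFrom]
            convert this using 2
            exact List.filter_congr fun q hq => by simpa using hab q hq)
        have hhigh := ih4 (z.filter fun q => a ≤ q.1) (hz.filter _)
          (by
            simpa [lettersBelow, lettersFrom, List.filter_map, Function.comp_def]
              using hw.filter (a ≤ ·))
          (by
            have := hv.filter (b ≤ ·)
            rw [List.filter_map] at this
            dsimp only [lettersBelow, lettersFrom]
            convert this using 2
            exact List.filter_congr fun q hq => by
              have := hab q hq
              simp only [Function.comp_def, decide_eq_decide]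
              dsimp only at this
              omega)
        have hlen := List.length_eq_length_filter_add (l := z) (fun q => decide (q.1 < a))
        have : (z.filter fun q => !decide (q.1 < a)) = z.filter fun q => a ≤ q.1 :=
          List.filter_congr fun q _ => by simp [← decide_not]
        rw [this] at hlen
        simp only [List.length_cons]
        dsimp only at hlow hhigh
        omega
    rw [commonSubword, length_longestOfThree]
    simp only [List.length_cons, List.length_append]
    omega

/-- The words with distinct letters that avoid `231`. Unlike `IsPerm231Avoiding` this passes to
subsequences. -/
def Avoids231 (w : List ℕ) : Prop :=
  w.Nodup ∧ ∀ a b c, List.Sublist [a, b, c] w → ¬ (c < a ∧ a < b)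

theorem Avoids231.sublist {u w : List ℕ} (hw : Avoids231 w) (h : List.Sublist u w) :
    Avoids231 u :=
  ⟨hw.1.sublist h, fun a b c hs => hw.2 a b c (hs.trans h)⟩

/-- After a letter `a` in a word that avoids `231`, the letters smaller than `a` precede those
greater than `a`. -/
theorem Avoids231.lettersBelow_append_lettersFrom {a : ℕ} {w : List ℕ} (h : Avoids231 (a :: w)) :
    lettersBelow a w ++ lettersFrom a w = w := by
  induction w with
  | nil => rfl
  | cons b w ih =>
    have hw : Avoids231 (a :: w) := h.sublist (by simp)
    rcases lt_or_ge b a with hb | hb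
    · simpa [lettersBelow, lettersFrom, hb, List.filter_cons, not_le.2 hb] using ih hw
    · have hne : a ≠ b := by have := h.1; simp at this; tauto
      have hall : ∀ c ∈ w, a ≤ c := by
        intro c hc
        by_contra hca
        refine h.2 a b c ?_ ⟨by omega, by omega⟩
        simpa using hc
      have e1 : lettersBelow a w = [] := by simpa [lettersBelow, lettersFrom] using hall
      have e2 : lettersFrom a w = w := by simpa [lettersBelow, lettersFrom] using hall
      rw [lettersBelow] at e1
      rw [lettersFrom] at e2
      simp [lettersBelow, lettersFrom, hb, e1, e2]

/-- If the words avoid `231`, then the result of the recursion is indeed a common pattern: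
concatenating smaller and greater letters yields a subsequence. -/
theorem exists_concordant_commonSubword (w v : List ℕ) (hw : Avoids231 w) (hv : Avoids231 v) :
    ∃ z : List (ℕ × ℕ), Concordant z ∧ z.map Prod.fst = commonSubword w v ∧
      List.Sublist (z.map Prod.fst) w ∧ List.Sublist (z.map Prod.snd) v := by
  induction w, v using commonSubword.induct with
  | case1 v => exact ⟨[], List.Pairwise.nil, by simp [commonSubword]⟩
  | case2 a w => exact ⟨[], List.Pairwise.nil, by simp [commonSubword]⟩
  | case3 a w b v ih3 ih4 ih1 ih2 =>
    have hw' : Avoids231 w := hw.sublist (List.sublist_cons_self _ _)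
    have hv' : Avoids231 v := hv.sublist (List.sublist_cons_self _ _)
    rw [commonSubword]
    rcases longestOfThree_cases
      (a :: (commonSubword (lettersBelow a w) (lettersBelow b v) ++
        commonSubword (lettersFrom a w) (lettersFrom b v)))
      (commonSubword w (b :: v)) (commonSubword (a :: w) v) with h | h | h <;> rw [h]
    · obtain ⟨zl, cl, el, wl, vl⟩ := ih3 (hw'.sublist (lettersBelow_sublist a w))
        (hv'.sublist (lettersBelow_sublist b v))
      obtain ⟨zh, ch, eh, wh, vh⟩ := ih4 (hw'.sublist (lettersFrom_sublist a w))
        (hv'.sublist (lettersFrom_sublist b v))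
      have lw : ∀ p ∈ zl, p.1 < a := fun p hp => by
        have := wl.subset (List.mem_map_of_mem hp); simp [lettersBelow] at this; exact this.2
      have lv : ∀ p ∈ zl, p.2 < b := fun p hp => by
        have := vl.subset (List.mem_map_of_mem hp); simp [lettersBelow] at this; exact this.2
      have gw : ∀ p ∈ zh, a ≤ p.1 := fun p hp => by
        have := wh.subset (List.mem_map_of_mem hp); simp [lettersFrom] at this; exact this.2
      have gv : ∀ p ∈ zh, b ≤ p.2 := fun p hp => by
        have := vh.subset (List.mem_map_of_mem hp); simp [lettersFrom] at this; exact this.2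
      refine ⟨(a, b) :: (zl ++ zh), ?_, ?_, ?_, ?_⟩
      · refine List.pairwise_cons.2 ⟨?_, List.pairwise_append.2 ⟨cl, ch, ?_⟩⟩
        · intro q hq
          rcases List.mem_append.1 hq with hq | hq
          · simp [lw q hq, lv q hq]
          · simp [not_lt.2 (gw q hq), not_lt.2 (gv q hq)]
        · intro p hp q hq
          have := lw p hp; have := lv p hp; have := gw q hq; have := gv q hq
          omega
      · simp [el, eh]
      · simp only [List.map_cons, List.map_append]
        conv_rhs => rw [← hw.lettersBelow_append_lettersFrom]
        exact (wl.append wh).cons_cons _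
      · simp only [List.map_cons, List.map_append]
        conv_rhs => rw [← hv.lettersBelow_append_lettersFrom]
        exact (vl.append vh).cons_cons _
    · obtain ⟨z, c, e, s, t⟩ := ih1 hw' hv
      exact ⟨z, c, e, s.cons _, t⟩
    · obtain ⟨z, c, e, s, t⟩ := ih2 hw hv'
      exact ⟨z, c, e, s, t.cons _⟩

/-! ### Order isomorphism and normalization -/

theorem Concordant.normalizeWord_eq {z : List (ℕ × ℕ)} (hz : Concordant z)
    (h1 : (z.map Prod.fst).Nodup) (h2 : (z.map Prod.snd).Nodup) :
    normalizeWord (z.map Prod.fst) = normalizeWord (z.map Prod.snd) := by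
  have key : ∀ p ∈ z, ∀ q ∈ z, (q.1 ≤ p.1 ↔ q.2 ≤ p.2) := by
    have h : z.Pairwise fun p q => (q.1 ≤ p.1 ↔ q.2 ≤ p.2) ∧ (p.1 ≤ q.1 ↔ p.2 ≤ q.2) := by
      have h1' := List.pairwise_map.1 h1
      have h2' := List.pairwise_map.1 h2
      refine (hz.and (h1'.and h2')).imp ?_
      rintro p q ⟨h, h1, h2⟩
      omega
    intro p hp q hq
    have : Std.Symm fun p q : ℕ × ℕ =>
        (q.1 ≤ p.1 ↔ q.2 ≤ p.2) ∧ (p.1 ≤ q.1 ↔ p.2 ≤ q.2) := ⟨fun _ _ h => And.symm h⟩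
    exact (List.Pairwise.forall_of_forall (fun _ _ => by simp) h hp hq).1
  unfold normalizeWord
  simp only [List.map_map]
  refine List.map_congr_left fun p hp => ?_
  simp only [Function.comp_def, List.countP_map]
  exact List.countP_congr fun q hq => by simpa using key p hp q hq

theorem countP_le_lt_countP_le_iff {w : List ℕ} {a b : ℕ} (ha : a ∈ w) :
    w.countP (fun x => decide (x ≤ b)) < w.countP (fun x => decide (x ≤ a)) ↔ b < a := by
  constructor
  · intro h
    by_contra hab
    refine absurd h (not_lt.2 (List.countP_mono_left fun x _ hx => ?_))
    simp at hx ⊢; omega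
  · intro hab
    induction w with
    | nil => simp at ha
    | cons c w ih =>
      have hle : w.countP (fun x => decide (x ≤ b)) ≤ w.countP (fun x => decide (x ≤ a)) :=
        List.countP_mono_left fun x _ hx => by simp at hx ⊢; omega
      simp only [List.countP_cons, decide_eq_true_eq]
      rcases List.mem_cons.1 ha with rfl | ha
      · rw [if_neg (by omega), if_pos le_rfl]; omega
      · have := ih ha
        split_ifs <;> omega

/-- Words with the same normalization are order isomorphic, since the order of the letters is that
of their ranks. This needs no assumption on repeated letters. -/
theorem concordant_zip_of_normalizeWord_eq {s t : List ℕ}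
    (h : normalizeWord s = normalizeWord t) : Concordant (s.zip t) := by
  have hlen : s.length = t.length := by simpa [normalizeWord] using congrArg List.length h
  have hget : ∀ i (hi : i < s.length) (hi' : i < t.length),
      s.countP (fun x => decide (x ≤ s[i])) = t.countP (fun x => decide (x ≤ t[i])) := by
    intro i hi hi'
    have := congrArg (fun l => l[i]?) h
    simpa [normalizeWord, hi, hi'] using this
  refine List.pairwise_iff_getElem.2 fun i j hi hj hij => ?_
  simp only [List.length_zip, lt_min_iff] at hi hj
  simp only [List.getElem_zip]
  rw [← countP_le_lt_countP_le_iff (List.getElem_mem hi.1),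
    ← countP_le_lt_countP_le_iff (List.getElem_mem hi.2), hget i hi.1 hi.2, hget j hj.1 hj.2]

theorem IsPerm231Avoiding.avoids231 {w : List ℕ} (h : IsPerm231Avoiding w) : Avoids231 w := by
  refine ⟨h.1.nodup_iff.2 List.nodup_range', fun a b c hs hlt => h.2 ⟨[a, b, c], hs, ?_⟩⟩
  have h1 : ¬ b ≤ a := by omega
  have h2 : c ≤ a := by omega
  have h3 : a ≤ b := by omega
  have h4 : c ≤ b := by omega
  have h5 : ¬ a ≤ c := by omega
  have h6 : ¬ b ≤ c := by omega
  simp [normalizeWord, List.countP_cons, h1, h2, h3, h4, h5, h6]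

theorem isGreatestCommonPattern_commonSubword {v w : List ℕ} (hv : Avoids231 v)
    (hw : Avoids231 w) :
    IsGreatestCommonPattern (normalizeWord (commonSubword v w)) v w := by
  obtain ⟨z, hz, he, h1, h2⟩ := exists_concordant_commonSubword v w hv hw
  refine ⟨⟨_, he ▸ h1, rfl⟩, ⟨_, h2, ?_⟩, ?_⟩
  · rw [← he, hz.normalizeWord_eq (hv.1.sublist h1) (hw.1.sublist h2)]
  · rintro x ⟨s, hs, rfl⟩ ⟨t, ht, hst⟩
    have hlen : t.length = s.length := by simpa [normalizeWord] using congrArg List.length hst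
    have := length_le_commonSubword v w (s.zip t) (concordant_zip_of_normalizeWord_eq hst.symm)
      (by rwa [List.map_fst_zip hlen.ge]) (by rwa [List.map_snd_zip hlen.le])
    simpa [normalizeWord, hlen] using this

/-! ### Program fragments and their execution -/

namespace RAM

/-- `Reaches P t c d`: started in `c`, the program `P` is in the configuration `d` after `t`
steps. -/
inductive Reaches (P : Program) : ℕ → Config → Config → Prop where
  | refl (c : Config) : Reaches P 0 c c
  | head (t : ℕ) (c c' d : Config) (h : step P c = some c') (hd : Reaches P t c' d) :
      Reaches P (t + 1) c d

theorem Reaches.trans {P : Program} {s t : ℕ} {c d e : Config} (h : Reaches P s c d)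
    (h' : Reaches P t d e) : Reaches P (s + t) c e := by
  induction h with
  | refl c => simpa using h'
  | head s c c' d hs _ ih =>
    rw [Nat.add_right_comm]
    exact .head _ _ _ _ hs (ih h')

theorem Reaches.haltsIn {P : Program} {t : ℕ} {c d : Config} (h : Reaches P t c d)
    (hd : step P d = none) : HaltsIn P t c d := by
  induction h with
  | refl c => exact .done c hd
  | head s c c' d hs _ ih => exact .next _ _ _ _ hs (ih hd)

/-- `SitsAt P pc code`: the instructions `code` stand in the program `P` from number `pc` on. -/
def SitsAt (P : Program) : ℕ → List Instr → Prop
  | _, [] => True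
  | pc, i :: code => P[pc]? = some i ∧ SitsAt P (pc + 1) code

theorem sitsAt_append {P : Program} {pc : ℕ} {a b : List Instr} :
    SitsAt P pc (a ++ b) ↔ SitsAt P pc a ∧ SitsAt P (pc + a.length) b := by
  induction a generalizing pc with
  | nil => simp [SitsAt]
  | cons i a ih =>
    simp only [List.cons_append, SitsAt, ih, List.length_cons, and_assoc,
      Nat.add_assoc, Nat.add_comm 1]

theorem sitsAt_self (P : Program) : SitsAt P 0 P := by
  have key : ∀ a b : List Instr, SitsAt (a ++ b) a.length b := by
    intro a b
    induction b generalizing a with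
    | nil => trivial
    | cons i b ih =>
      refine ⟨by simp, ?_⟩
      simpa using ih (a ++ [i])
  simpa using key [] P

/-- A program fragment: the instructions as a function of the number of the first one. Jumps are
absolute, so this number is needed to write down their targets. -/
abbrev Fragment : Type := ℕ → List Instr

/-- `Executes g T reg mem Q`: wherever the fragment `g` stands in a program, if control enters it
at its beginning with registers `reg` and memory `mem`, then control leaves it at its end after at
most `T` steps, with registers and memory satisfying `Q`. -/
def Executes (g : Fragment) (T : ℕ) (reg mem : ℕ → ℕ) (Q : (ℕ → ℕ) → (ℕ → ℕ) → Prop) : Prop :=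
  ∀ (P : Program) (pc : ℕ), SitsAt P pc (g pc) →
    ∃ (t : ℕ) (reg' mem' : ℕ → ℕ), t ≤ T ∧ Q reg' mem' ∧
      Reaches P t ⟨pc, reg, mem⟩ ⟨pc + (g pc).length, reg', mem'⟩

theorem Executes.mono {g : Fragment} {T T' : ℕ} {reg mem : ℕ → ℕ}
    {Q Q' : (ℕ → ℕ) → (ℕ → ℕ) → Prop} (h : Executes g T reg mem Q) (hT : T ≤ T')
    (hQ : ∀ r m, Q r m → Q' r m) : Executes g T' reg mem Q' := by
  intro P pc hs
  obtain ⟨t, r, m, ht, hq, hr⟩ := h P pc hs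
  exact ⟨t, r, m, ht.trans hT, hQ _ _ hq, hr⟩

namespace Fragment

/-- A single instruction. -/
def single (i : Instr) : Fragment := fun _ => [i]

/-- Sequential composition. -/
def seq (g h : Fragment) : Fragment := fun pc => g pc ++ h (pc + (g pc).length)

/-- `ifZero t g h` executes `g` if `R t = 0`, and `h` otherwise; `R (t + 1)` is overwritten. -/
def ifZero (t : ℕ) (g h : Fragment) : Fragment := fun pc =>
  let h' := h (pc + 1)
  let g' := g (pc + 1 + h'.length + 2)
  [.jumpZero t (pc + 1 + h'.length + 2)] ++ (h' ++
    ([.const (t + 1) 0, .jumpZero (t + 1) (pc + 1 + h'.length + 2 + g'.length)] ++ g'))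

/-- `loop x g` executes `g` for `R x = 0, 1, …, N - 1`, where `N = R 0`; `R (x + 1)` is
overwritten. -/
def loop (x : ℕ) (g : Fragment) : Fragment := fun pc =>
  let g' := g (pc + 3)
  [.const x 0, .sub (x + 1) 0 x, .jumpZero (x + 1) (pc + 3 + g'.length + 4)] ++ (g' ++
    [.const (x + 1) 1, .add x x (x + 1), .const (x + 1) 0, .jumpZero (x + 1) (pc + 1)])

end Fragment

section Single

variable {reg mem : ℕ → ℕ} {Q : (ℕ → ℕ) → (ℕ → ℕ) → Prop}

theorem executes_single {i : Instr} {reg' mem' : ℕ → ℕ}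
    (h : ∀ pc, exec ⟨pc, reg, mem⟩ i = ⟨pc + 1, reg', mem'⟩) (hQ : Q reg' mem') :
    Executes (.single i) 1 reg mem Q := by
  intro P pc hs
  refine ⟨1, reg', mem', le_rfl, hQ, .head _ _ _ _ ?_ (.refl _)⟩
  simp only [step, hs.1, Option.map_some, h]
  rfl

theorem executes_const {t c : ℕ} (h : Q (Function.update reg t c) mem) :
    Executes (.single (.const t c)) 1 reg mem Q :=
  executes_single (fun _ => rfl) h

theorem executes_add {t a b : ℕ} (h : Q (Function.update reg t (reg a + reg b)) mem) :
    Executes (.single (.add t a b)) 1 reg mem Q :=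
  executes_single (fun _ => rfl) h

theorem executes_sub {t a b : ℕ} (h : Q (Function.update reg t (reg a - reg b)) mem) :
    Executes (.single (.sub t a b)) 1 reg mem Q :=
  executes_single (fun _ => rfl) h

theorem executes_load {t a : ℕ} (h : Q (Function.update reg t (mem (reg a))) mem) :
    Executes (.single (.load t a)) 1 reg mem Q :=
  executes_single (fun _ => rfl) h

theorem executes_store {a b : ℕ} (h : Q reg (Function.update mem (reg a) (reg b))) :
    Executes (.single (.store a b)) 1 reg mem Q :=
  executes_single (fun _ => rfl) h

end Single

theorem Executes.seq {g h : Fragment} {T T' : ℕ} {reg mem : ℕ → ℕ}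
    {Q R : (ℕ → ℕ) → (ℕ → ℕ) → Prop} (hg : Executes g T reg mem Q)
    (hh : ∀ r m, Q r m → Executes h T' r m R) : Executes (g.seq h) (T + T') reg mem R := by
  intro P pc hs
  obtain ⟨hs1, hs2⟩ := sitsAt_append.1 hs
  obtain ⟨t, r, m, ht, hq, hr⟩ := hg P pc hs1
  obtain ⟨t', r', m', ht', hq', hr'⟩ := hh r m hq P _ hs2
  refine ⟨t + t', r', m', by omega, hq', ?_⟩
  have := hr.trans hr'
  simpa [Fragment.seq, Nat.add_assoc] using this

theorem executes_const_seq {g : Fragment} {T t c : ℕ} {reg mem : ℕ → ℕ}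
    {Q : (ℕ → ℕ) → (ℕ → ℕ) → Prop} (h : Executes g T (Function.update reg t c) mem Q) :
    Executes ((Fragment.single (.const t c)).seq g) (1 + T) reg mem Q :=
  Executes.seq (Q := fun r m => r = Function.update reg t c ∧ m = mem)
    (executes_const ⟨rfl, rfl⟩) fun _ _ ⟨hr, hm⟩ => hr ▸ hm ▸ h

theorem executes_ifZero {t : ℕ} {g h : Fragment} {T : ℕ} {reg mem : ℕ → ℕ}
    {Q : (ℕ → ℕ) → (ℕ → ℕ) → Prop}
    (hg : reg t = 0 → Executes g T reg mem Q) (hh : reg t ≠ 0 → Executes h T reg mem Q)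
    (hQ : ∀ r m, Q r m → Q (Function.update r (t + 1) 0) m) :
    Executes (Fragment.ifZero t g h) (T + 3) reg mem Q := by
  intro P pc hs
  simp only [Fragment.ifZero, sitsAt_append, SitsAt, List.length_cons, List.length_nil,
    zero_add, and_true] at hs
  obtain ⟨h1, h2, ⟨h3, h4⟩, h5⟩ := hs
  have hlen : (Fragment.ifZero t g h pc).length = 1 + (h (pc + 1)).length + 2 +
      (g (pc + 1 + (h (pc + 1)).length + 2)).length := by
    simp only [Fragment.ifZero, List.length_append, List.length_cons, List.length_nil]
    omega
  rw [hlen]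
  by_cases h0 : reg t = 0
  · obtain ⟨k, r, m, hk, hq, hr⟩ := hg h0 P _ h5
    refine ⟨k + 1, r, m, by omega, hq,
      .head _ _ ⟨pc + 1 + (h (pc + 1)).length + 2, reg, mem⟩ _ ?_ ?_⟩
    · simp [step, h1, exec, h0]
    · simpa [Nat.add_assoc] using hr
  · obtain ⟨k, r, m, hk, hq, hr⟩ := hh h0 P _ h2
    refine ⟨k + 2 + 1, _, m, by omega, hQ _ _ hq, .head _ _ ⟨pc + 1, reg, mem⟩ _ ?_
      (hr.trans (.head _ _ ⟨pc + 1 + (h (pc + 1)).length + 1, Function.update r (t + 1) 0, m⟩ _ ?_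
        (.head _ _ _ _ ?_ (.refl _))))⟩
    · simp [step, h1, exec, h0]
    · simp [step, h3, exec]
    · simp [step, h4, exec]
      omega

/-- The invariant `I k` holds before the execution of the body for `R x = k`. It may not depend on
the loop counter and on the registers above it. -/
theorem executes_loop {x N T : ℕ} {g : Fragment} {reg mem : ℕ → ℕ}
    (I : ℕ → (ℕ → ℕ) → (ℕ → ℕ) → Prop) (hx : 0 < x)
    (hI : ∀ k r m y v, x ≤ y → I k r m → I k (Function.update r y v) m)
    (hg : ∀ k r m, k < N → I k r m → r 0 = N → r x = k →
      Executes g T r m fun r' m' => I (k + 1) r' m' ∧ r' 0 = N ∧ r' x = k)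
    (h0 : I 0 reg mem) (hN : reg 0 = N) :
    Executes (Fragment.loop x g) (N * (T + 6) + 3) reg mem (I N) := by
  intro P pc hs
  simp only [Fragment.loop, sitsAt_append, SitsAt, List.length_cons, List.length_nil,
    zero_add, and_true] at hs
  obtain ⟨⟨h1, h2, h3⟩, h4, h5, h6, h7, h8⟩ := hs
  have hlen : (Fragment.loop x g pc).length = 3 + (g (pc + 3)).length + 4 := by
    simp only [Fragment.loop, List.length_append, List.length_cons, List.length_nil]
    omega
  rw [hlen]
  have main : ∀ n k r m, k + n = N → I k r m → r 0 = N → r x = k →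
      ∃ (t : ℕ) (r' m' : ℕ → ℕ), t ≤ n * (T + 6) + 2 ∧ I N r' m' ∧
        Reaches P t ⟨pc + 1, r, m⟩ ⟨pc + (3 + (g (pc + 3)).length + 4), r', m'⟩ := by
    intro n
    induction n with
    | zero =>
      intro k r m hk hi hr0 hrx
      obtain rfl : k = N := by omega
      refine ⟨2, Function.update r (x + 1) 0, m, by omega, hI _ _ _ _ _ (by omega) hi,
        .head _ _ ⟨pc + 2, Function.update r (x + 1) 0, m⟩ _ ?_ (.head _ _ _ _ ?_ (.refl _))⟩
      · simp [step, h2, exec, hr0, hrx]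
      · simp [step, h3, exec, Nat.add_assoc]
    | succ n ih =>
      intro k r m hk hi hr0 hrx
      set r1 := Function.update r (x + 1) (N - k) with hr1
      have a0 : r1 0 = N := by simp [hr1, Function.update_of_ne, hr0]
      have ax : r1 x = k := by simp [hr1, Function.update_of_ne, hrx]
      obtain ⟨t, r2, m2, ht, ⟨hi2, b0, bx⟩, hr⟩ := hg k r1 m (by omega)
        (hI _ _ _ _ _ (by omega) hi) a0 ax P _ h4
      set r3 := Function.update r2 (x + 1) 1 with hr3
      set r4 := Function.update r3 x (k + 1) with hr4
      set r5 := Function.update r4 (x + 1) 0 with hr5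
      have c0 : r5 0 = N := by
        simp [hr5, hr4, hr3, Function.update_of_ne, b0, hx.ne]
      have cx : r5 x = k + 1 := by simp [hr5, hr4, Function.update_of_ne]
      obtain ⟨t', r6, m6, ht', hi6, hr6⟩ := ih (k + 1) r5 m2 (by omega)
        (hI _ _ _ _ _ (by omega) (hI _ _ _ _ _ le_rfl (hI _ _ _ _ _ (by omega) hi2))) c0 cx
      refine ⟨t + (t' + 4) + 2, r6, m6, by rw [Nat.succ_mul]; omega, hi6,
        .head _ _ ⟨pc + 2, r1, m⟩ _ ?_ (.head _ _ ⟨pc + 3, r1, m⟩ _ ?_ (hr.trans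
          (.head _ _ ⟨pc + 3 + (g (pc + 3)).length + 1, r3, m2⟩ _ ?_
          (.head _ _ ⟨pc + 3 + (g (pc + 3)).length + 2, r4, m2⟩ _ ?_
          (.head _ _ ⟨pc + 3 + (g (pc + 3)).length + 3, r5, m2⟩ _ ?_
          (.head _ _ _ _ ?_ hr6))))))⟩
      · simp [step, h2, exec, hr1, hr0, hrx]
      · have : N - k ≠ 0 := by omega
        simp [step, h3, exec, hr1, this]
      · simp [step, h5, exec, hr3]
      · simp [step, h6, exec, hr4, hr3, Function.update_of_ne, bx]
      · simp [step, h7, exec, hr5]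
      · simp [step, h8, exec, hr5]
  obtain ⟨t, r', m', ht, hi, hr⟩ := main N 0 (Function.update reg x 0) mem (by omega)
    (hI _ _ _ _ _ le_rfl h0) (by simp [Function.update_of_ne, hx.ne, hN]) (by simp)
  refine ⟨t + 1, r', m', by omega, hi, .head _ _ _ _ ?_ hr⟩
  simp [step, h1, exec]

/-! ### A structured language whose loops all have the same length -/

/-- Expressions over a list of local variables. Variables are numbered from the outermost binder
on, starting with `0`. -/
inductive Exp : Type where
  /-- a number -/
  | const (c : ℕ)
  /-- the common length `N` of all loops -/
  | size
  /-- a local variable -/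
  | var (k : ℕ)
  /-- addition -/
  | add (a b : Exp)
  /-- truncated subtraction -/
  | sub (a b : Exp)
  /-- the content of a memory cell -/
  | load (a : Exp)
  /-- `a` if `c = 0`, and `b` otherwise -/
  | ifZero (c a b : Exp)
  /-- the sum of `a` for the next variable running through `0, …, N - 1` -/
  | sum (a : Exp)

/-- Commands that only change the memory. -/
inductive Cmd : Type where
  /-- `M a := b` -/
  | store (a b : Exp)
  /-- sequential composition -/
  | seq (c d : Cmd)
  /-- run `c` for the next variable running through `0, …, N - 1` -/
  | loop (c : Cmd)
  /-- run `c` with the value of `a` as the next variable -/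
  | bind (a : Exp) (c : Cmd)

/-- The value of an expression; `N` is the loop length, `ρ` holds the variables, `m` is the
memory. Variables that are not bound have the value `0`. -/
def Exp.eval (N : ℕ) (m : ℕ → ℕ) : Exp → List ℕ → ℕ
  | const c, _ => c
  | size, _ => N
  | var k, ρ => ρ.getD k 0
  | add a b, ρ => a.eval N m ρ + b.eval N m ρ
  | sub a b, ρ => a.eval N m ρ - b.eval N m ρ
  | load a, ρ => m (a.eval N m ρ)
  | ifZero c a b, ρ => if c.eval N m ρ = 0 then a.eval N m ρ else b.eval N m ρ
  | sum a, ρ => ∑ x ∈ Finset.range N, a.eval N m (ρ ++ [x])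

/-- `iterUpTo f k s` applies `f 0`, `f 1`, …, `f (k - 1)` to `s`, in this order. -/
def iterUpTo {α : Type} (f : ℕ → α → α) : ℕ → α → α
  | 0, s => s
  | k + 1, s => f k (iterUpTo f k s)

theorem iterUpTo_induction {α : Type} {f : ℕ → α → α} {n : ℕ} (I : ℕ → α → Prop)
    {s : α} (h0 : I 0 s) (h : ∀ k s, k < n → I k s → I (k + 1) (f k s)) :
    I n (iterUpTo f n s) := by
  have : ∀ k ≤ n, I k (iterUpTo f k s) := by
    intro k
    induction k with
    | zero => exact fun _ => h0
    | succ k ih => exact fun hk => h _ _ hk (ih (by omega))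
  exact this n le_rfl

/-- The effect of a command on the memory. -/
def Cmd.run (N : ℕ) : Cmd → List ℕ → (ℕ → ℕ) → ℕ → ℕ
  | store a b, ρ, m => Function.update m (a.eval N m ρ) (b.eval N m ρ)
  | seq c d, ρ, m => d.run N ρ (c.run N ρ m)
  | loop c, ρ, m => iterUpTo (fun x m => c.run N (ρ ++ [x]) m) N m
  | bind a c, ρ, m => c.run N (ρ ++ [a.eval N m ρ]) m

theorem Cmd.run_seq (N : ℕ) (c d : Cmd) (ρ : List ℕ) (m : ℕ → ℕ) :
    (seq c d).run N ρ m = d.run N ρ (c.run N ρ m) := rfl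

theorem Cmd.run_bind (N : ℕ) (a : Exp) (c : Cmd) (ρ : List ℕ) (m : ℕ → ℕ) :
    (bind a c).run N ρ m = c.run N (ρ ++ [a.eval N m ρ]) m := rfl

/-! ### Compilation -/

open Fragment in
/-- The code for an expression. The variables are in the registers `vars`, the result is put into
`R t`, and only registers from `R t` on are used for intermediate results. -/
def Exp.compile : Exp → List ℕ → ℕ → Fragment
  | const c, _, t => single (.const t c)
  | size, _, t => (single (.const t 0)).seq (single (.add t t 0))
  | var k, vars, t => (single (.const t 0)).seq
      (match vars[k]? with
        | some r => single (.add t t r)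
        | none => single (.const t 0))
  | add a b, vars, t => (a.compile vars t).seq
      ((b.compile vars (t + 1)).seq (single (.add t t (t + 1))))
  | sub a b, vars, t => (a.compile vars t).seq
      ((b.compile vars (t + 1)).seq (single (.sub t t (t + 1))))
  | load a, vars, t => (a.compile vars t).seq (single (.load t t))
  | ifZero c a b, vars, t => (c.compile vars t).seq
      (Fragment.ifZero t (a.compile vars t) (b.compile vars t))
  | sum a, vars, t => (single (.const t 0)).seq (Fragment.loop (t + 1)
      ((a.compile (vars ++ [t + 1]) (t + 2)).seq (single (.add t t (t + 2)))))

/-- A bound for the number of steps of the code for an expression, as a polynomial in the loop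
length. -/
noncomputable def Exp.time : Exp → Polynomial ℕ
  | const _ => 1
  | size => 2
  | var _ => 2
  | add a b => a.time + (b.time + 1)
  | sub a b => a.time + (b.time + 1)
  | load a => a.time + 1
  | ifZero c a b => c.time + (a.time + b.time + 3)
  | sum a => 1 + (Polynomial.X * (a.time + 1 + 6) + 3)

/-- The code for a command, with the conventions of `Exp.compile`. -/
def Cmd.compile : Cmd → List ℕ → ℕ → Fragment
  | store a b, vars, t => (a.compile vars t).seq
      ((b.compile vars (t + 1)).seq (.single (.store t (t + 1))))
  | seq c d, vars, t => (c.compile vars t).seq (d.compile vars t)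
  | loop c, vars, t => Fragment.loop t (c.compile (vars ++ [t]) (t + 1))
  | bind a c, vars, t => (a.compile vars t).seq (c.compile (vars ++ [t]) (t + 1))

/-- A bound for the number of steps of the code for a command, as a polynomial in the loop
length. -/
noncomputable def Cmd.time : Cmd → Polynomial ℕ
  | store a b => a.time + (b.time + 1)
  | seq c d => c.time + d.time
  | loop c => Polynomial.X * (c.time + 6) + 3
  | bind a c => a.time + c.time

/-- The registers `vars`, all of them below `t`, hold the values `ρ`. -/
def Holds (t : ℕ) (reg : ℕ → ℕ) (vars ρ : List ℕ) : Prop :=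
  List.Forall₂ (fun r v => r < t ∧ reg r = v) vars ρ

theorem Holds.of_agree {t t' : ℕ} {reg reg' : ℕ → ℕ} {vars ρ : List ℕ}
    (h : Holds t reg vars ρ) (htt' : t ≤ t') (ha : ∀ r < t, reg' r = reg r) :
    Holds t' reg' vars ρ :=
  h.imp fun r _ hrv => ⟨hrv.1.trans_le htt', (ha r hrv.1).trans hrv.2⟩

theorem Holds.append {t x : ℕ} {reg : ℕ → ℕ} {vars ρ : List ℕ} (h : Holds t reg vars ρ)
    {y : ℕ} (hy : y < t) (hx : reg y = x) : Holds t reg (vars ++ [y]) (ρ ++ [x]) :=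
  List.rel_append h (.cons ⟨hy, hx⟩ .nil)

/-- Correctness of the code for an expression, within the time bound. The last conjunct allows
variables and intermediate results to be kept in the registers below `R t`. -/
theorem Exp.executes_compile (N : ℕ) (mem : ℕ → ℕ) (e : Exp) (ρ vars : List ℕ) (t : ℕ)
    (reg : ℕ → ℕ) (ht : 0 < t) (hN : reg 0 = N) (hv : Holds t reg vars ρ) :
    Executes (e.compile vars t) (e.time.eval N) reg mem fun reg' mem' =>
      mem' = mem ∧ reg' t = e.eval N mem ρ ∧ ∀ r < t, reg' r = reg r := by
  induction e generalizing ρ vars t reg with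
  | const c =>
    rw [show (const c).time.eval N = 1 by simp [time]]
    exact executes_const ⟨rfl, by simp [eval], fun r hr => Function.update_of_ne hr.ne _ _⟩
  | size =>
    rw [show size.time.eval N = 1 + 1 by simp [time]]
    refine executes_const_seq (executes_add ⟨rfl, ?_, fun r hr => ?_⟩)
    · simp [Function.update_of_ne ht.ne, hN, eval]
    · simp [Function.update_of_ne hr.ne]
  | var k =>
    rw [show (var k).time.eval N = 1 + 1 by simp [time]]
    refine executes_const_seq ?_
    have hk : (vars[k]? = none ∧ ρ[k]? = none) ∨
        ∃ r, vars[k]? = some r ∧ ρ[k]? = some (reg r) ∧ r < t := by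
      have hl := hv.length_eq
      rcases lt_or_ge k vars.length with h | h
      · right
        have := List.Forall₂.get hv h (hl ▸ h)
        simp only [List.get_eq_getElem] at this
        exact ⟨vars[k], by simp [h], by simp [hl ▸ h, this.2], this.1⟩
      · left
        simp [h, hl ▸ h]
    rcases hk with ⟨h1, h2⟩ | ⟨r, h1, h2, h3⟩
    · simp only [h1]
      refine executes_const ⟨rfl, ?_, fun r hr => ?_⟩
      · simp [eval, h2]
      · simp [Function.update_of_ne hr.ne]
    · simp only [h1]
      refine executes_add ⟨rfl, ?_, fun r hr => ?_⟩
      · simp [eval, h2, Function.update_of_ne h3.ne]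
      · simp [Function.update_of_ne hr.ne]
  | add a b iha ihb =>
    rw [show (add a b).time.eval N = a.time.eval N + (b.time.eval N + 1) by simp [time]]
    refine (iha ρ vars t reg ht hN hv).seq ?_
    rintro r m ⟨rfl, h1, h2⟩
    refine (ihb ρ vars (t + 1) r (by omega) ((h2 0 ht).trans hN)
      (hv.of_agree (by omega) h2)).seq ?_
    rintro r' m' ⟨rfl, h1', h2'⟩
    refine executes_add ⟨rfl, ?_, fun s hs => ?_⟩
    · simp [eval, h1', h2' t (by omega), h1]
    · simp [Function.update_of_ne hs.ne, h2' s (by omega), h2 s hs]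
  | sub a b iha ihb =>
    rw [show (sub a b).time.eval N = a.time.eval N + (b.time.eval N + 1) by simp [time]]
    refine (iha ρ vars t reg ht hN hv).seq ?_
    rintro r m ⟨rfl, h1, h2⟩
    refine (ihb ρ vars (t + 1) r (by omega) ((h2 0 ht).trans hN)
      (hv.of_agree (by omega) h2)).seq ?_
    rintro r' m' ⟨rfl, h1', h2'⟩
    refine executes_sub ⟨rfl, ?_, fun s hs => ?_⟩
    · simp [eval, h1', h2' t (by omega), h1]
    · simp [Function.update_of_ne hs.ne, h2' s (by omega), h2 s hs]
  | load a iha =>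
    rw [show (load a).time.eval N = a.time.eval N + 1 by simp [time]]
    refine (iha ρ vars t reg ht hN hv).seq ?_
    rintro r m ⟨rfl, h1, h2⟩
    refine executes_load ⟨rfl, ?_, fun s hs => ?_⟩
    · simp [eval, h1]
    · simp [Function.update_of_ne hs.ne, h2 s hs]
  | ifZero c a b ihc iha ihb =>
    refine ((ihc ρ vars t reg ht hN hv).seq fun r m h => executes_ifZero
      (T := a.time.eval N + b.time.eval N)
      (Q := fun reg' mem' => mem' = mem ∧ reg' t = (Exp.ifZero c a b).eval N mem ρ ∧
        ∀ s < t, reg' s = reg s) (fun h0 => ?_) (fun h0 => ?_) ?_).mono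
          (by simp [time]) fun _ _ h => h
    · obtain ⟨rfl, h1, h2⟩ := h
      refine (iha ρ vars t r ht ((h2 0 ht).trans hN) (hv.of_agree le_rfl h2)).mono (by omega) ?_
      rintro r' m' ⟨rfl, h1', h2'⟩
      rw [h1] at h0
      exact ⟨rfl, by simp [eval, h0, h1'], fun s hs => (h2' s hs).trans (h2 s hs)⟩
    · obtain ⟨rfl, h1, h2⟩ := h
      refine (ihb ρ vars t r ht ((h2 0 ht).trans hN) (hv.of_agree le_rfl h2)).mono (by omega) ?_
      rintro r' m' ⟨rfl, h1', h2'⟩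
      rw [h1] at h0
      exact ⟨rfl, by simp [eval, h0, h1'], fun s hs => (h2' s hs).trans (h2 s hs)⟩
    · rintro r' m' ⟨h1, h2, h3⟩
      refine ⟨h1, by simpa using h2, fun s hs => ?_⟩
      rw [Function.update_of_ne (by omega), h3 s hs]
  | sum a iha =>
    rw [show (sum a).time.eval N = 1 + (N * (a.time.eval N + 1 + 6) + 3) by simp [time]]
    refine executes_const_seq (executes_loop (N := N)
      (fun k r m => m = mem ∧ r t = ∑ x ∈ Finset.range k, a.eval N mem (ρ ++ [x]) ∧
        ∀ s < t, r s = reg s) (by omega) ?_ ?_ ?_ ?_)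
    · rintro k r m y v hy ⟨h1, h2, h3⟩
      refine ⟨h1, ?_, fun s hs => ?_⟩
      · rw [Function.update_of_ne (by omega), h2]
      · rw [Function.update_of_ne (by omega), h3 s hs]
    · rintro k r m hk ⟨rfl, h2, h3⟩ hr0 hrx
      refine (iha (ρ ++ [k]) (vars ++ [t + 1]) (t + 2) r (by omega) hr0
        ((hv.of_agree (by omega) h3).append (by omega) hrx)).seq ?_
      rintro r' m' ⟨rfl, h1', h2'⟩
      refine executes_add ⟨⟨rfl, ?_, fun s hs => ?_⟩, ?_, ?_⟩
      · simp [Finset.sum_range_succ, h1', h2' t (by omega), h2]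
      · rw [Function.update_of_ne hs.ne, h2' s (by omega), h3 s hs]
      · rw [Function.update_of_ne ht.ne, h2' 0 (by omega), hr0]
      · rw [Function.update_of_ne (by omega), h2' _ (by omega), hrx]
    · exact ⟨rfl, by simp, fun s hs => by rw [Function.update_of_ne hs.ne]⟩
    · rw [Function.update_of_ne ht.ne, hN]

theorem Cmd.executes_compile (N : ℕ) (c : Cmd) (mem : ℕ → ℕ) (ρ vars : List ℕ) (t : ℕ)
    (reg : ℕ → ℕ) (ht : 0 < t) (hN : reg 0 = N) (hv : Holds t reg vars ρ) :
    Executes (c.compile vars t) (c.time.eval N) reg mem fun reg' mem' =>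
      mem' = c.run N ρ mem ∧ ∀ r < t, reg' r = reg r := by
  induction c generalizing mem ρ vars t reg with
  | store a b =>
    rw [show (store a b).time.eval N = a.time.eval N + (b.time.eval N + 1) by simp [time]]
    refine (a.executes_compile N mem ρ vars t reg ht hN hv).seq ?_
    rintro r m ⟨rfl, h1, h2⟩
    refine (b.executes_compile N m ρ vars (t + 1) r (by omega) ((h2 0 ht).trans hN)
        (hv.of_agree (by omega) h2)).seq ?_
    rintro r' m' ⟨rfl, h1', h2'⟩
    refine executes_store ⟨?_, fun s hs => ?_⟩
    · rw [h1', h2' t (by omega), h1, run]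
    · rw [h2' s (by omega), h2 s hs]
  | seq c d ihc ihd =>
    rw [show (seq c d).time.eval N = c.time.eval N + d.time.eval N by simp [time]]
    refine (ihc mem ρ vars t reg ht hN hv).seq ?_
    rintro r m ⟨rfl, h2⟩
    refine (ihd _ ρ vars t r ht ((h2 0 ht).trans hN) (hv.of_agree le_rfl h2)).mono le_rfl ?_
    rintro r' m' ⟨rfl, h2'⟩
    exact ⟨rfl, fun s hs => (h2' s hs).trans (h2 s hs)⟩
  | loop c ih =>
    rw [show (loop c).time.eval N = N * (c.time.eval N + 6) + 3 by simp [time]]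
    refine executes_loop (N := N) (fun k r m =>
      m = iterUpTo (fun x m => c.run N (ρ ++ [x]) m) k mem ∧ ∀ s < t, r s = reg s) ht
        ?_ ?_ ?_ hN
    · rintro k r m y v hy ⟨h1, h2⟩
      exact ⟨h1, fun s hs => by rw [Function.update_of_ne (by omega), h2 s hs]⟩
    · rintro k r m hk ⟨h1, h2⟩ hr0 hrx
      refine (ih m (ρ ++ [k]) (vars ++ [t]) (t + 1) r (by omega) hr0
        ((hv.of_agree (by omega) h2).append (by omega) hrx)).mono le_rfl ?_
      rintro r' m' ⟨h1', h2'⟩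
      refine ⟨⟨?_, fun s hs => ?_⟩, ?_, ?_⟩
      · rw [h1', h1, iterUpTo]
      · rw [h2' s (by omega), h2 s hs]
      · rw [h2' 0 (by omega), hr0]
      · rw [h2' t (by omega), hrx]
    · exact ⟨rfl, fun s _ => rfl⟩
  | bind a c ih =>
    rw [show (bind a c).time.eval N = a.time.eval N + c.time.eval N by simp [time]]
    refine (a.executes_compile N mem ρ vars t reg ht hN hv).seq ?_
    rintro r m ⟨rfl, h1, h2⟩
    refine (ih m (ρ ++ [a.eval N m ρ]) (vars ++ [t]) (t + 1) r (by omega)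
      ((h2 0 ht).trans hN) ((hv.of_agree (by omega) h2).append (by omega) h1)).mono le_rfl ?_
    rintro r' m' ⟨h1', h2'⟩
    exact ⟨h1', fun s hs => (h2' s (by omega)).trans (h2 s hs)⟩

/-- A problem is solvable in polynomial time if a command solves it whose loop length is the value
of an expression `e` that is linearly bounded in the size of the instance. -/
theorem solvableInPolyTime_of_cmd {α : Type} {encode : α → List ℕ} {size : α → ℕ}
    {valid : α → Prop} {sol : α → List ℕ → Prop} (e : Exp) (c : Cmd) (N : α → ℕ)
    (q : Polynomial ℕ) (hN : ∀ a, valid a → e.eval 0 (init (encode a)).mem [] = N a)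
    (hq : ∀ a, valid a → N a = q.eval (size a))
    (hc : ∀ a, valid a → ∀ pc reg,
      sol a (output ⟨pc, reg, c.run (N a) [] (init (encode a)).mem⟩)) :
    SolvableInPolyTime encode size valid sol := by
  let g : Fragment := (e.compile [] 1).seq ((Fragment.single (.const 2 0)).seq
    ((Fragment.single (.add 0 1 2)).seq (c.compile [] 1)))
  refine ⟨g 0, Polynomial.C (e.time.eval 0 + 2) + c.time.comp q, fun a ha => ?_⟩
  set mem := (init (encode a)).mem with hmem
  have hg : Executes g (e.time.eval 0 + (1 + (1 + c.time.eval (N a)))) (fun _ => 0) mem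
      fun _ mem' => mem' = c.run (N a) [] mem := by
    refine (e.executes_compile 0 mem [] [] 1 _ one_pos rfl .nil).seq fun r m h => ?_
    obtain ⟨rfl, h1, h2⟩ := h
    -- The first expression is evaluated with loop length `0`; its value becomes the loop length.
    refine executes_const_seq ?_
    refine Executes.seq (Q := fun r' m' => r' = Function.update (Function.update r 2 0) 0
      (Function.update r 2 0 1 + Function.update r 2 0 2) ∧ m' = mem) (executes_add ⟨rfl, rfl⟩) ?_
    rintro r' m' ⟨rfl, rfl⟩
    refine (c.executes_compile (N a) _ [] [] 1 _ one_pos ?_ .nil).mono le_rfl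
      fun _ _ h => h.1
    simpa [h1] using hN a ha
  obtain ⟨t, r, m, ht, rfl, hr⟩ := hg (g 0) 0 (sitsAt_self _)
  refine ⟨t, ⟨0 + (g 0).length, r, c.run (N a) [] mem⟩, ?_, ?_, hc a ha _ _⟩
  · rw [Polynomial.eval_add, Polynomial.eval_C, Polynomial.eval_comp, ← hq a ha]
    omega
  · exact Reaches.haltsIn hr (by simp [step])

end RAM

/-! ### Segments of words -/

/-- The letters of `w` at the places `i, i + 1, …, j - 1`, counted from `0`. -/
def wordSegment (w : List ℕ) (i j : ℕ) : List ℕ := (w.drop i).take (j - i)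

theorem wordSegment_sublist (w : List ℕ) (i j : ℕ) : List.Sublist (wordSegment w i j) w :=
  (List.take_sublist _ _).trans (List.drop_sublist _ _)

theorem wordSegment_eq_nil {w : List ℕ} {i j : ℕ} (h : j ≤ i) : wordSegment w i j = [] := by
  simp [wordSegment, Nat.sub_eq_zero_of_le h]

theorem wordSegment_eq_cons {w : List ℕ} {i j : ℕ} (hij : i < j) (hj : j ≤ w.length) :
    wordSegment w i j = w.getD i 0 :: wordSegment w (i + 1) j := by
  have hi : i < w.length := by omega
  unfold wordSegment
  rw [List.drop_eq_getElem_cons hi, show j - i = (j - (i + 1)) + 1 by omega, List.take_succ_cons]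
  simp [hi]

theorem wordSegment_zero_length (w : List ℕ) : wordSegment w 0 w.length = w := by
  simp [wordSegment]

theorem length_wordSegment {w : List ℕ} {i j : ℕ} (hj : j ≤ w.length) :
    (wordSegment w i j).length = j - i := by
  simp only [wordSegment, List.length_take, List.length_drop]
  omega

theorem countP_wordSegment (p : ℕ → Bool) {w : List ℕ} {i j : ℕ} (hij : i ≤ j) (hj : j ≤ w.length) :
    (wordSegment w i j).countP p = ∑ q ∈ Finset.Ico i j, if p (w.getD q 0) then 1 else 0 := by
  induction hij using Nat.decreasingInduction with
  | self => simp [wordSegment_eq_nil]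
  | of_succ i hi ih =>
    rw [wordSegment_eq_cons hi hj, List.countP_cons, ih,
      Finset.sum_eq_sum_Ico_succ_bot hi, add_comm]

/-- In the segment from `i` to `j` of a word that avoids `231`, the place where the letters after
the first one stop being smaller than the first one. -/
def splitPlace (w : List ℕ) (i j : ℕ) : ℕ :=
  i + 1 + (lettersBelow (w.getD i 0) (wordSegment w (i + 1) j)).length

theorem splitPlace_le {w : List ℕ} {i j : ℕ} (hij : i < j) (hj : j ≤ w.length) :
    splitPlace w i j ≤ j := by
  have := (lettersBelow_sublist (w.getD i 0) (wordSegment w (i + 1) j)).length_le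
  rw [length_wordSegment hj] at this
  unfold splitPlace
  omega

theorem splitPlace_eq_sum {w : List ℕ} {i j N : ℕ} (hij : i < j) (hj : j ≤ w.length)
    (hN : j ≤ N) : splitPlace w i j = i + 1 + ∑ q ∈ Finset.range N,
      if i + 1 ≤ q then if q + 1 ≤ j then if w.getD q 0 + 1 ≤ w.getD i 0 then 1 else 0 else 0
        else 0 := by
  rw [splitPlace, lettersBelow, ← List.countP_eq_length_filter, countP_wordSegment _ (by omega) hj]
  congr 1
  have : Finset.Ico (i + 1) j = (Finset.range N).filter fun q => i + 1 ≤ q ∧ q + 1 ≤ j := by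
    ext q
    simp only [Finset.mem_Ico, Finset.mem_filter, Finset.mem_range]
    omega
  rw [this, Finset.sum_filter]
  refine Finset.sum_congr rfl fun q _ => ?_
  simp only [decide_eq_true_eq, Nat.succ_le_iff, ite_and]

theorem Avoids231.segment_split {w : List ℕ} (hw : Avoids231 w) {i j : ℕ} (hij : i < j)
    (hj : j ≤ w.length) :
    lettersBelow (w.getD i 0) (wordSegment w (i + 1) j) = wordSegment w (i + 1) (splitPlace w i j) ∧
    lettersFrom (w.getD i 0) (wordSegment w (i + 1) j) = wordSegment w (splitPlace w i j) j := by
  set a := w.getD i 0 with ha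
  set s := wordSegment w (i + 1) j with hs
  have happ : lettersBelow a s ++ lettersFrom a s = s := by
    refine (hw.sublist ?_).lettersBelow_append_lettersFrom
    rw [ha, hs, ← wordSegment_eq_cons hij hj]
    exact wordSegment_sublist w i j
  have hle := (lettersBelow_sublist a s).length_le
  rw [hs, length_wordSegment hj, ← hs] at hle
  have htake : s.take (lettersBelow a s).length = lettersBelow a s := by
    have := List.take_left (l₁ := lettersBelow a s) (l₂ := lettersFrom a s)
    rwa [happ] at this
  have hdrop : s.drop (lettersBelow a s).length = lettersFrom a s := by
    have := List.drop_left (l₁ := lettersBelow a s) (l₂ := lettersFrom a s)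
    rwa [happ] at this
  rw [splitPlace, ← ha, ← hs]
  refine ⟨htake.symm.trans ?_, hdrop.symm.trans ?_⟩ <;>
    generalize (lettersBelow a s).length = c at hle ⊢ <;> rw [hs, wordSegment, wordSegment]
  · rw [List.take_take]
    congr 1
    omega
  · rw [List.drop_take, List.drop_drop]
    congr 1
    omega

theorem commonSubword_segment {w v : List ℕ} (hw : Avoids231 w) (hv : Avoids231 v)
    {i j k l : ℕ} (hij : i < j) (hj : j ≤ w.length) (hkl : k < l) (hl : l ≤ v.length) :
    commonSubword (wordSegment w i j) (wordSegment v k l) = longestOfThree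
      (w.getD i 0 ::
        (commonSubword (wordSegment w (i + 1) (splitPlace w i j))
            (wordSegment v (k + 1) (splitPlace v k l)) ++
          commonSubword (wordSegment w (splitPlace w i j) j) (wordSegment v (splitPlace v k l) l)))
      (commonSubword (wordSegment w (i + 1) j) (wordSegment v k l))
      (commonSubword (wordSegment w i j) (wordSegment v (k + 1) l)) := by
  rw [wordSegment_eq_cons hij hj, wordSegment_eq_cons hkl hl, commonSubword,
    (hw.segment_split hij hj).1, (hw.segment_split hij hj).2,
    (hv.segment_split hkl hl).1, (hv.segment_split hkl hl).2]

/-! ### Positional numbers -/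

theorem digit_lt {N a a' b : ℕ} (b' : ℕ) (h : a < a') (hb : b < N) :
    N * a + b < N * a' + b' := by
  have := Nat.mul_le_mul_left N (Nat.succ_le_of_lt h)
  rw [Nat.mul_succ] at this
  omega

theorem digit_inj {N a a' b b' : ℕ} (h : N * a + b = N * a' + b') (hb : b < N) (hb' : b' < N) :
    a = a' ∧ b = b' := by
  rcases lt_trichotomy a a' with ha | rfl | ha
  · have := digit_lt b' ha hb; omega
  · exact ⟨rfl, by omega⟩
  · have := digit_lt b ha hb'; omega

/-- The number with the digits `x`, `y`, `j`, `l`, `p` in base `N`. -/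
def rank (N x y j l p : ℕ) : ℕ := N * (N * (N * (N * x + y) + j) + l) + p

theorem rank_inj {N x y j l p x' y' j' l' p' : ℕ}
    (h : rank N x y j l p = rank N x' y' j' l' p') (hy : y < N) (hj : j < N) (hl : l < N)
    (hp : p < N) (hy' : y' < N) (hj' : j' < N) (hl' : l' < N) (hp' : p' < N) :
    x = x' ∧ y = y' ∧ j = j' ∧ l = l' ∧ p = p' := by
  obtain ⟨h1, rfl⟩ := digit_inj h hp hp'
  obtain ⟨h2, rfl⟩ := digit_inj h1 hl hl'
  obtain ⟨h3, rfl⟩ := digit_inj h2 hj hj'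
  obtain ⟨rfl, rfl⟩ := digit_inj h3 hy hy'
  simp

theorem rank_lt_of_fst_lt {N x y j l p x' : ℕ} (y' j' l' p' : ℕ) (h : x < x') (hy : y < N)
    (hj : j < N) (hl : l < N) (hp : p < N) : rank N x y j l p < rank N x' y' j' l' p' :=
  digit_lt _ (digit_lt _ (digit_lt _ (digit_lt _ h hy) hj) hl) hp

theorem rank_lt_of_snd_lt {N x y j l p y' : ℕ} (j' l' p' : ℕ) (h : y < y')
    (hj : j < N) (hl : l < N) (hp : p < N) : rank N x y j l p < rank N x y' j' l' p' :=
  digit_lt _ (digit_lt _ (digit_lt _ (by omega) hj) hl) hp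

/-! ### The program -/

namespace RAM

namespace Exp

/-- `u` if `a ≤ b`, and `v` otherwise. -/
def ifLe (a b u v : Exp) : Exp := ifZero (sub a b) u v

theorem eval_ifLe (N : ℕ) (M : ℕ → ℕ) (ρ : List ℕ) (a b u v : Exp) :
    (ifLe a b u v).eval N M ρ =
      if a.eval N M ρ ≤ b.eval N M ρ then u.eval N M ρ else v.eval N M ρ := by
  simp only [ifLe, eval, Nat.sub_eq_zero_iff_le]

/-- The address of the first cell of the table entry with the digits `x`, `y`, `j`, `l`. The
table begins in cell `N`. A summand that does not depend on the summation variable is multiplied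
by `N`. -/
def entryAddress (x y j l : Exp) : Exp :=
  add size (sum (add (sum (add (sum (add (sum x) y)) j)) l))

/-- The letter at the place `q` of the word that begins in the cell `b`. -/
def letter (b q : Exp) : Exp := load (add b q)

/-- The place `splitPlace w i j` for the word `w` that begins in the cell `b`; `d` is the number
of local variables. -/
def split (d : ℕ) (b i j : Exp) : Exp :=
  add (add i (const 1)) (sum (ifLe (add i (const 1)) (var d)
    (ifLe (add (var d) (const 1)) j
      (ifLe (add (letter b (var d)) (const 1)) (letter b i) (const 1) (const 0))
      (const 0)) (const 0)))

/-- The content of the cell `p` of the table entry for the segments `i, …, j - 1` and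
`k, …, l - 1`, where `a` is the letter of the first word at the place `i`, and `xLow`, `xHigh`,
`xLeft`, `xRight` are the addresses of the entries from which it is computed. -/
def entryCell (i j k l a xLow xHigh xLeft xRight p : Exp) : Exp :=
  let matched := add (const 1) (add (load xLow) (load xHigh))
  let p' := sub p (const 1)
  let matchedCell := ifZero p matched (ifZero p' a
    (ifLe p' (load xLow) (load (add xLow p')) (load (add xHigh (sub p' (load xLow))))))
  let dropCell := ifLe (load xRight) (load xLeft) (load (add xLeft p)) (load (add xRight p))
  ifLe j i (const 0) (ifLe l k (const 0)
    (ifLe (load xLeft) matched (ifLe (load xRight) matched matchedCell dropCell) dropCell))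

end Exp

namespace Cmd

open Exp

/-- Computes all cells of one table entry. The variables `0, …, 5` are the lengths of the two words
and the digits `x`, `y`, `j`, `l` of the entry; the entry is about the segments `i, …, j - 1` and
`k, …, l - 1` for `i = N - 1 - x`, `k = N - 1 - y`. -/
def fillEntry : Cmd :=
  bind (sub (sub size (const 1)) (var 2)) <|
  bind (sub (sub size (const 1)) (var 3)) <|
  bind (split 8 (const 1) (var 6) (var 4)) <|
  bind (split 9 (add (var 0) (const 2)) (var 7) (var 5)) <|
  bind (entryAddress (sub (var 2) (const 1)) (sub (var 3) (const 1)) (var 8) (var 9)) <|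
  bind (entryAddress (sub (sub size (const 1)) (var 8)) (sub (sub size (const 1)) (var 9))
    (var 4) (var 5)) <|
  bind (entryAddress (sub (var 2) (const 1)) (var 3) (var 4) (var 5)) <|
  bind (entryAddress (var 2) (sub (var 3) (const 1)) (var 4) (var 5)) <|
  loop <| store (add (entryAddress (var 2) (var 3) (var 4) (var 5)) (var 14))
    (entryCell (var 6) (var 4) (var 7) (var 5) (letter (const 1) (var 6))
      (var 10) (var 11) (var 12) (var 13) (var 14))

/-- Normalizes the word in the table entry with the address in the variable `2`, and writes its
length and its letters into the cells from `R` on, where `R` is the variable `3`. -/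
def normalizeEntry : Cmd :=
  loop <| store (add (var 3) (var 4))
    (ifZero (var 4) (load (var 2))
      (sum (ifLe (add (var 5) (const 1)) (load (var 2))
        (ifLe (load (add (add (var 2) (const 1)) (var 5))) (load (add (var 2) (var 4)))
          (const 1) (const 0)) (const 0))))

/-- The program for greatest common patterns. The output replaces the input only at the end. -/
def greatestCommonPattern : Cmd :=
  bind (load (const 0)) <|
  bind (load (add (var 0) (const 1))) <|
  seq (loop <| loop <| loop <| loop fillEntry) <|
  bind (entryAddress (sub size (const 1)) (sub size (const 1)) (var 0) (var 1)) <|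
  bind (entryAddress size (const 0) (const 0) (const 0)) <|
  seq normalizeEntry <|
  loop <| store (var 4) (load (add (var 3) (var 4)))

end Cmd

/-- The table entry for a word: its length, followed by its letters. -/
def entry (u : List ℕ) (p : ℕ) : ℕ := (u.length :: u).getD p 0

theorem entry_zero (u : List ℕ) : entry u 0 = u.length := rfl

theorem entry_nil (p : ℕ) : entry [] p = 0 := by
  cases p <;> rfl

theorem entry_cons_append (a : ℕ) (u v : List ℕ) (p : ℕ) :
    entry (a :: (u ++ v)) p = if p = 0 then 1 + (u.length + v.length)
      else if p - 1 = 0 then a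
      else if p - 1 ≤ u.length then entry u (p - 1) else entry v (p - 1 - u.length) := by
  rcases p with _ | _ | p
  · simp only [entry, List.getD_cons_zero, List.length_cons, List.length_append, if_true]
    omega
  · rfl
  · simp only [entry, Nat.add_sub_cancel, List.getD_cons_succ, Nat.add_eq_zero_iff, one_ne_zero,
      and_false, if_false]
    split_ifs with h
    · rw [List.getD_append _ _ _ _ (by omega)]
    · rw [List.getD_append_right _ _ _ _ (by omega),
        show p + 1 - u.length = (p - u.length) + 1 by omega, List.getD_cons_succ]

/-- The memory `M` holds the words `w` and `v`, and the table for them is correct as far as the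
cells of rank smaller than `c` are concerned. The cells are ordered such that each entry is
computed from earlier ones. Nothing is required of the entries where `j` or `l` exceeds the length
of the word; they are written by the program, but not read. -/
structure TableFilled (N : ℕ) (w v : List ℕ) (c : ℕ) (M : ℕ → ℕ) : Prop where
  left : ∀ q < w.length, M (1 + q) = w.getD q 0
  right : ∀ q < v.length, M (w.length + 2 + q) = v.getD q 0
  table : ∀ x y j l p, x < N → y < N → j ≤ w.length → l ≤ v.length → p < N →
    rank N x y j l p < c → M (N + rank N x y j l p) =
      entry (commonSubword (wordSegment w (N - 1 - x) j) (wordSegment v (N - 1 - y) l)) p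

theorem TableFilled.update {N : ℕ} {w v : List ℕ} {x y j l p z : ℕ} {M : ℕ → ℕ}
    (hN : N = w.length + v.length + 2) (h : TableFilled N w v (rank N x y j l p) M)
    (hy : y < N) (hj : j < N) (hl : l < N) (hp : p < N)
    (hz : j ≤ w.length → l ≤ v.length →
      z = entry (commonSubword (wordSegment w (N - 1 - x) j) (wordSegment v (N - 1 - y) l)) p) :
    TableFilled N w v (rank N x y j l p + 1)
      (Function.update M (N + rank N x y j l p) z) := by
  refine ⟨fun q hq => ?_, fun q hq => ?_, fun x' y' j' l' p' hx' hy' hj' hl' hp' hr => ?_⟩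
  · rw [Function.update_of_ne (by omega), h.left q hq]
  · rw [Function.update_of_ne (by omega), h.right q hq]
  · rcases Nat.lt_succ_iff_lt_or_eq.1 hr with hr | hr
    · rw [Function.update_of_ne (by omega), h.table x' y' j' l' p' hx' hy' hj' hl' hp' hr]
    · obtain ⟨rfl, rfl, rfl, rfl, rfl⟩ := rank_inj hr hy' (by omega) (by omega) hp' hy hj hl hp
      rw [Function.update_self, hz hj' hl']

theorem eval_entryAddress (N : ℕ) (M : ℕ → ℕ) (ρ : List ℕ) (x y j l : Exp) {x' y' j' l' : ℕ}
    (hx : ∀ a b c d, x.eval N M (ρ ++ [a] ++ [b] ++ [c] ++ [d]) = x')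
    (hy : ∀ a b c, y.eval N M (ρ ++ [a] ++ [b] ++ [c]) = y')
    (hj : ∀ a b, j.eval N M (ρ ++ [a] ++ [b]) = j') (hl : ∀ a, l.eval N M (ρ ++ [a]) = l') :
    (Exp.entryAddress x y j l).eval N M ρ = N + rank N x' y' j' l' 0 := by
  simp only [Exp.entryAddress, Exp.eval, hx, hy, hj, hl, Finset.sum_const, Finset.card_range,
    smul_eq_mul, rank, add_zero]

/-! ### Correctness of the program -/

theorem rank_add (N x y j l p : ℕ) : rank N x y j l p = rank N x y j l 0 + p := rfl

theorem eval_split (N : ℕ) (M : ℕ → ℕ) (ρ : List ℕ) (w : List ℕ) (b i j : Exp) {b' i' j' : ℕ}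
    (hi : i.eval N M ρ = i')
    (hb1 : ∀ a, b.eval N M (ρ ++ [a]) = b') (hi1 : ∀ a, i.eval N M (ρ ++ [a]) = i')
    (hj1 : ∀ a, j.eval N M (ρ ++ [a]) = j')
    (hM : ∀ q < w.length, M (b' + q) = w.getD q 0)
    (hij : i' < j') (hjw : j' ≤ w.length) (hN : j' ≤ N) :
    (Exp.split ρ.length b i j).eval N M ρ = splitPlace w i' j' := by
  have hvar : ∀ a, (ρ ++ [a]).getD ρ.length 0 = a := fun a => by simp
  simp only [Exp.split, Exp.letter, Exp.eval, Exp.eval_ifLe, hi, hb1, hi1, hj1, hvar]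
  rw [splitPlace_eq_sum hij hjw hN]
  congr 1
  refine Finset.sum_congr rfl fun q _ => ?_
  by_cases h1 : i' + 1 ≤ q
  · by_cases h2 : q + 1 ≤ j'
    · rw [if_pos h1, if_pos h2, if_pos h1, if_pos h2, hM q (by omega), hM i' (by omega)]
    · rw [if_pos h1, if_neg h2, if_pos h1, if_neg h2]
  · rw [if_neg h1, if_neg h1]

/-- The cell computed by `Exp.entryCell` is correct if the four entries from which it is computed
are correct. If one of the segments is empty, nothing is required of them. -/
theorem eval_entryCell {N : ℕ} {w v : List ℕ} (hw : Avoids231 w) (hv : Avoids231 v)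
    {M : ℕ → ℕ} {ρ : List ℕ} {ei ej ek el ea exLow exHigh exLeft exRight ep : Exp}
    {i j k l xLow xHigh xLeft xRight p : ℕ}
    (hi : ei.eval N M ρ = i) (hj : ej.eval N M ρ = j) (hk : ek.eval N M ρ = k)
    (hl : el.eval N M ρ = l) (hLow : exLow.eval N M ρ = xLow) (hHigh : exHigh.eval N M ρ = xHigh)
    (hLeft : exLeft.eval N M ρ = xLeft) (hRight : exRight.eval N M ρ = xRight)
    (hp : ep.eval N M ρ = p) (hpN : p < N) (hjw : j ≤ w.length) (hlv : l ≤ v.length)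
    (ha : i < j → ea.eval N M ρ = w.getD i 0)
    (mLow : i < j → k < l → ∀ p < N, M (xLow + p) = entry
      (commonSubword (wordSegment w (i + 1) (splitPlace w i j))
        (wordSegment v (k + 1) (splitPlace v k l))) p)
    (mHigh : i < j → k < l → ∀ p < N, M (xHigh + p) = entry
      (commonSubword (wordSegment w (splitPlace w i j) j) (wordSegment v (splitPlace v k l) l)) p)
    (mLeft : i < j → k < l → ∀ p < N, M (xLeft + p) =
      entry (commonSubword (wordSegment w (i + 1) j) (wordSegment v k l)) p)
    (mRight : i < j → k < l → ∀ p < N, M (xRight + p) =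
      entry (commonSubword (wordSegment w i j) (wordSegment v (k + 1) l)) p) :
    (Exp.entryCell ei ej ek el ea exLow exHigh exLeft exRight ep).eval N M ρ =
      entry (commonSubword (wordSegment w i j) (wordSegment v k l)) p := by
  simp only [Exp.entryCell, Exp.eval_ifLe, Exp.eval, hi, hj, hk, hl, hLow, hHigh, hLeft, hRight, hp]
  rcases le_or_gt j i with hij | hij
  · rw [if_pos hij, wordSegment_eq_nil hij, commonSubword_nil_left, entry_nil]
  rcases le_or_gt l k with hkl | hkl
  · rw [if_neg (by omega), if_pos hkl, wordSegment_eq_nil hkl, commonSubword_nil_right, entry_nil]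
  rw [if_neg (by omega), if_neg (by omega), commonSubword_segment hw hv hij hjw hkl hlv, ha hij]
  replace mLow := mLow hij hkl
  replace mHigh := mHigh hij hkl
  replace mLeft := mLeft hij hkl
  replace mRight := mRight hij hkl
  have zLow := mLow 0 (by omega)
  have zHigh := mHigh 0 (by omega)
  have zLeft := mLeft 0 (by omega)
  have zRight := mRight 0 (by omega)
  rw [add_zero, entry_zero] at zLow zHigh zLeft zRight
  rw [zLow, zHigh, zLeft, zRight, mLeft p hpN, mRight p hpN, mLow _ (by omega),
    mHigh _ (by omega), ← entry_cons_append]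
  unfold longestOfThree
  simp only [List.length_cons, List.length_append, Nat.add_comm _ 1]
  split_ifs <;> first | rfl | (exfalso; omega)

theorem TableFilled.run_fillEntry {N : ℕ} {w v : List ℕ} (hw : Avoids231 w) (hv : Avoids231 v)
    (hN : N = w.length + v.length + 2) {x y j l : ℕ} (hx : x < N) (hy : y < N) (hj : j < N)
    (hl : l < N) {M : ℕ → ℕ} (h : TableFilled N w v (rank N x y j l 0) M) :
    TableFilled N w v (rank N x y j (l + 1) 0)
      (Cmd.fillEntry.run N [w.length, v.length, x, y, j, l] M) := by
  simp only [Cmd.fillEntry, Cmd.run, List.cons_append, List.nil_append]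
  have ei : (Exp.sub (Exp.sub Exp.size (Exp.const 1)) (Exp.var 2)).eval N M
      [w.length, v.length, x, y, j, l] = N - 1 - x := rfl
  have ek : (Exp.sub (Exp.sub Exp.size (Exp.const 1)) (Exp.var 3)).eval N M
      [w.length, v.length, x, y, j, l, N - 1 - x] = N - 1 - y := rfl
  rw [ei, ek]
  set i := N - 1 - x with hi
  set k := N - 1 - y with hk
  generalize he : (Exp.split 8 _ _ _).eval N M _ = e
  generalize hf : (Exp.split 9 _ _ _).eval N M _ = f
  rw [eval_entryAddress (x' := x - 1) (y' := y - 1) (j' := e) (l' := f),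
    eval_entryAddress (x' := N - 1 - e) (y' := N - 1 - f) (j' := j) (l' := l),
    eval_entryAddress (x' := x - 1) (y' := y) (j' := j) (l' := l),
    eval_entryAddress (x' := x) (y' := y - 1) (j' := j) (l' := l)]
  rotate_left
  iterate 16 (intros; rfl)
  have he' : i < j → j ≤ w.length → e = splitPlace w i j := fun hij hjw => by
    rw [← he]
    exact eval_split N M [w.length, v.length, x, y, j, l, i, k] w _ _ _ rfl
      (fun _ => rfl) (fun _ => rfl) (fun _ => rfl) h.left hij hjw hj.le
  have hf' : k < l → l ≤ v.length → f = splitPlace v k l := fun hkl hlv => by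
    rw [← hf]
    exact eval_split N M [w.length, v.length, x, y, j, l, i, k, e] v _ _ _ rfl
      (fun _ => rfl) (fun _ => rfl) (fun _ => rfl) h.right hkl hlv hl.le
  have hend : rank N x y j (l + 1) 0 = rank N x y j l N := by
    unfold rank; ring
  rw [hend]
  refine iterUpTo_induction (fun p M' => TableFilled N w v (rank N x y j l p) M') h
    fun p M' hp hM' => ?_
  rw [Exp.eval, eval_entryAddress (x' := x) (y' := y) (j' := j) (l' := l)]
  rotate_left
  iterate 4 (intros; rfl)
  change TableFilled N w v (rank N x y j l p + 1)
    (Function.update M' (N + rank N x y j l 0 + p) _)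
  rw [add_assoc N, ← rank_add]
  refine hM'.update hN hy hj hl hp fun hjw hlv => ?_
  -- The entries that are read have smaller rank, since their segments begin further right.
  have key : ∀ x' y' j' l' p', (x' < x ∨ x' = x ∧ y' < y) → y' < N → j' ≤ j → l' ≤ l → p' < N →
      M' (N + rank N x' y' j' l' 0 + p') = entry
        (commonSubword (wordSegment w (N - 1 - x') j') (wordSegment v (N - 1 - y') l')) p' := by
    intro x' y' j' l' p' hlt hy' hj' hl' hp'
    rw [add_assoc, ← rank_add]
    refine hM'.table x' y' j' l' p' (by omega) hy' (by omega) (by omega) hp' ?_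
    rcases hlt with hlt | ⟨rfl, hlt⟩
    · exact rank_lt_of_fst_lt _ _ _ _ hlt hy' (by omega) (by omega) hp'
    · exact rank_lt_of_snd_lt _ _ _ hlt (by omega) (by omega) hp'
  have hes : i < j → i < e ∧ e ≤ j := fun hij => by
    rw [he' hij hjw]
    exact ⟨by unfold splitPlace; omega, splitPlace_le hij hjw⟩
  have hfs : k < l → k < f ∧ f ≤ l := fun hkl => by
    rw [hf' hkl hlv]
    exact ⟨by unfold splitPlace; omega, splitPlace_le hkl hlv⟩
  refine eval_entryCell hw hv rfl rfl rfl rfl rfl rfl rfl rfl rfl hp hjw hlv ?_ ?_ ?_ ?_ ?_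
  · intro hij
    exact hM'.left i (by omega)
  · intro hij hkl p' hp'
    have h1 := hes hij
    have h2 := hfs hkl
    have := key (x - 1) (y - 1) e f p' (by omega) (by omega) (by omega) (by omega) hp'
    rw [show N - 1 - (x - 1) = i + 1 by omega, show N - 1 - (y - 1) = k + 1 by omega] at this
    rw [← he' hij hjw, ← hf' hkl hlv]
    exact this
  · intro hij hkl p' hp'
    have h1 := hes hij
    have h2 := hfs hkl
    have := key (N - 1 - e) (N - 1 - f) j l p' (by omega) (by omega) le_rfl le_rfl hp'
    rw [show N - 1 - (N - 1 - e) = e by omega, show N - 1 - (N - 1 - f) = f by omega] at this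
    rw [← he' hij hjw, ← hf' hkl hlv]
    exact this
  · intro hij hkl p' hp'
    have := key (x - 1) y j l p' (by omega) (by omega) le_rfl le_rfl hp'
    rw [show N - 1 - (x - 1) = i + 1 by omega] at this
    exact this
  · intro hij hkl p' hp'
    have := key x (y - 1) j l p' (by omega) (by omega) le_rfl le_rfl hp'
    rw [show N - 1 - (y - 1) = k + 1 by omega] at this
    exact this

/-- Since the rank is a positional number, the end of an inner loop is the next step of the loop
around it: the digit `N` amounts to a carry. -/
theorem TableFilled.run_loops {N : ℕ} {w v : List ℕ} (hw : Avoids231 w) (hv : Avoids231 v)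
    (hN : N = w.length + v.length + 2) {M : ℕ → ℕ} (h : TableFilled N w v 0 M) :
    TableFilled N w v (rank N N 0 0 0 0)
      ((Cmd.loop <| .loop <| .loop <| .loop Cmd.fillEntry).run N [w.length, v.length] M) := by
  simp only [Cmd.run, List.cons_append, List.nil_append]
  refine iterUpTo_induction (fun x M => TableFilled N w v (rank N x 0 0 0 0) M)
    (by simpa [rank] using h) fun x M hx hM => ?_
  rw [show rank N (x + 1) 0 0 0 0 = rank N x N 0 0 0 by unfold rank; ring]
  refine iterUpTo_induction (fun y M => TableFilled N w v (rank N x y 0 0 0) M) hM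
    fun y M hy hM => ?_
  rw [show rank N x (y + 1) 0 0 0 = rank N x y N 0 0 by unfold rank; ring]
  refine iterUpTo_induction (fun j M => TableFilled N w v (rank N x y j 0 0) M) hM
    fun j M hj hM => ?_
  rw [show rank N x y (j + 1) 0 0 = rank N x y j N 0 by unfold rank; ring]
  exact iterUpTo_induction (fun l M => TableFilled N w v (rank N x y j l 0) M) hM
    fun l M hl hM => hM.run_fillEntry hw hv hN hx hy hj hl

theorem countP_eq_sum_getD (p : ℕ → Bool) {u : List ℕ} {N : ℕ} (h : u.length ≤ N) :
    u.countP p = ∑ s ∈ Finset.range N,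
      if s + 1 ≤ u.length then if p (u.getD s 0) then 1 else 0 else 0 := by
  have := countP_wordSegment p (Nat.zero_le _) (le_refl u.length)
  rw [wordSegment_zero_length] at this
  have hIco : Finset.Ico 0 u.length = (Finset.range N).filter fun s => s + 1 ≤ u.length := by
    ext s
    simp only [Finset.mem_Ico, Finset.mem_filter, Finset.mem_range]
    omega
  rw [this, hIco, Finset.sum_filter]

/-- The letters of the normalization are counted from the table entry at `A`; the result is written
behind this entry, to `Z`. -/
theorem run_normalizeEntry {N n m A Z : ℕ} {u : List ℕ} (hu : u.length < N) (hAZ : A + N ≤ Z)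
    {M : ℕ → ℕ} (hM : ∀ p < N, M (A + p) = entry u p) :
    ∀ p ≤ u.length, Cmd.normalizeEntry.run N [n, m, A, Z] M (Z + p) =
      entry (normalizeWord u) p := by
  have main := iterUpTo_induction (n := N) (s := M)
    (f := fun t M' => (Cmd.store (.add (.var 3) (.var 4))
      (.ifZero (.var 4) (.load (.var 2))
      (.sum (.ifLe (.add (.var 5) (.const 1)) (.load (.var 2))
        (.ifLe (.load (.add (.add (.var 2) (.const 1)) (.var 5)))
          (.load (.add (.var 2) (.var 4))) (.const 1) (.const 0)) (.const 0))))).run N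
            ([n, m, A, Z] ++ [t]) M')
    (fun k M' => (∀ p < N, M' (A + p) = entry u p) ∧
      ∀ p ≤ u.length, p < k → M' (Z + p) = entry (normalizeWord u) p)
    ⟨hM, fun p _ hp => absurd hp (by omega)⟩ ?_
  · exact fun p hp => main.2 p hp (by omega)
  rintro t M' ht ⟨h1, h2⟩
  have h0 := h1 0 (by omega)
  rw [add_zero, entry_zero] at h0
  simp only [Cmd.run, List.cons_append, List.nil_append, Exp.eval, Exp.eval_ifLe,
    List.getD_cons_succ, List.getD_cons_zero]
  refine ⟨fun p hp => ?_, fun p hpu hpt => ?_⟩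
  · rw [Function.update_of_ne (by omega), h1 p hp]
  rcases Nat.lt_succ_iff_lt_or_eq.1 hpt with hpt | rfl
  · rw [Function.update_of_ne (by omega), h2 p hpu hpt]
  rw [Function.update_self, h0]
  rcases p with _ | p
  · simp [entry, normalizeWord]
  · rw [if_neg (by omega), h1 _ ht]
    have hp : p < u.length := by omega
    have : entry (normalizeWord u) (p + 1) = u.countP fun b => decide (b ≤ u[p]) := by
      simp [entry, normalizeWord, hp]
    rw [this, countP_eq_sum_getD _ hu.le]
    refine Finset.sum_congr rfl fun s _ => ?_
    split_ifs with hs h3 h4 h4 <;> try rfl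
    all_goals
      rw [add_assoc, add_comm 1, h1 _ (by omega)] at h3
      simp [entry, hp] at h3 h4
      omega

/-- A memory whose first cells hold a word in the form of a table entry outputs this word. -/
theorem output_eq_of_entry {u : List ℕ} {c : Config}
    (h : ∀ p ≤ u.length, c.mem p = entry u p) : output c = u := by
  have h0 : c.mem 0 = u.length := h 0 (Nat.zero_le _)
  refine List.ext_getElem (by simp [output, h0]) fun i hi hi' => ?_
  simp [output, h (i + 1) hi', entry, hi']

/-- The result for the whole words is read from the entry with `x = y = N - 1`, that is, with
`i = k = 0`, and with `j` and `l` the lengths of the words. -/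
theorem output_greatestCommonPattern {N : ℕ} {w v : List ℕ} (hw : Avoids231 w)
    (hv : Avoids231 v) (hN : N = w.length + v.length + 2) (pc : ℕ) (reg : ℕ → ℕ) :
    output ⟨pc, reg, Cmd.greatestCommonPattern.run N [] (init (encodeWordPair (w, v))).mem⟩ =
      normalizeWord (commonSubword w v) := by
  have hlen : (normalizeWord (commonSubword w v)).length = (commonSubword w v).length := by
    simp [normalizeWord]
  have hle : (commonSubword w v).length ≤ w.length := by
    obtain ⟨z, -, h1, h2, -⟩ := exists_concordant_commonSubword w v hw hv
    exact h1 ▸ h2.length_le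
  refine output_eq_of_entry ?_
  rw [hlen]
  set M0 := (init (encodeWordPair (w, v))).mem with hM0
  have hleft : ∀ q < w.length, M0 (1 + q) = w.getD q 0 := by
    intro q hq
    rw [hM0, add_comm]
    simp [init, encodeWordPair, List.getElem?_append, hq]
  have hright : ∀ q, M0 (w.length + 2 + q) = v.getD q 0 := by
    intro q
    rw [hM0, show w.length + 2 + q = (w.length + (q + 1)) + 1 by omega]
    simp [init, encodeWordPair, List.getElem?_append]
  have hn : M0 0 = w.length := by simp [hM0, init, encodeWordPair]
  have hm : M0 (w.length + 1) = v.length := by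
    simp [hM0, init, encodeWordPair]
  have hfill := TableFilled.run_loops hw hv hN (M := M0)
    ⟨hleft, fun q _ => hright q, fun _ _ _ _ _ _ _ _ _ _ h => absurd h (Nat.not_lt_zero _)⟩
  simp only [Cmd.greatestCommonPattern]
  simp only [Cmd.run_bind, Cmd.run_seq, List.nil_append, List.cons_append]
  rw [show (Exp.load (.const 0)).eval N M0 [] = w.length from hn,
    show (Exp.load (.add (.var 0) (.const 1))).eval N M0 [w.length] = v.length from hm]
  generalize (Cmd.loop (.loop (.loop (.loop Cmd.fillEntry)))).run N [w.length, v.length] M0 = M1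
    at hfill ⊢
  rw [eval_entryAddress (x' := N - 1) (y' := N - 1) (j' := w.length) (l' := v.length),
    eval_entryAddress (x' := N) (y' := 0) (j' := 0) (l' := 0)]
  rotate_left
  iterate 8 (intros; rfl)
  have hrank : ∀ p < N, rank N (N - 1) (N - 1) w.length v.length p < rank N N 0 0 0 0 :=
    fun p hp => rank_lt_of_fst_lt _ _ _ _ (by omega) (by omega) (by omega) (by omega) hp
  have hentry : ∀ p < N, M1 (N + rank N (N - 1) (N - 1) w.length v.length 0 + p) =
      entry (commonSubword w v) p := by
    intro p hp
    have := hfill.table (N - 1) (N - 1) w.length v.length p (by omega) (by omega) le_rfl le_rfl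
      hp (hrank p hp)
    rwa [Nat.sub_self, wordSegment_zero_length, wordSegment_zero_length, rank_add,
      ← add_assoc] at this
  have hnorm := run_normalizeEntry (n := w.length) (m := v.length) (Z := N + rank N N 0 0 0 0)
    (by omega) (by
      have := hrank (N - 1) (by omega)
      rw [rank_add] at this
      omega) hentry
  generalize Cmd.normalizeEntry.run N _ M1 = M2 at hnorm ⊢
  have main := iterUpTo_induction (n := N) (s := M2)
    (f := fun t M' => (Cmd.store (.var 4) (.load (.add (.var 3) (.var 4)))).run N
      ([w.length, v.length, N + rank N (N - 1) (N - 1) w.length v.length 0,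
        N + rank N N 0 0 0 0] ++ [t]) M')
    (fun k M' => (∀ p, M' (N + p) = M2 (N + p)) ∧
      ∀ p ≤ (commonSubword w v).length, p < k →
        M' p = entry (normalizeWord (commonSubword w v)) p)
    ⟨fun _ => rfl, fun p _ hp => absurd hp (by omega)⟩ ?_
  · exact fun p hp => main.2 p hp (by omega)
  rintro t M' ht ⟨h1, h2⟩
  simp only [Cmd.run, List.cons_append, List.nil_append, Exp.eval, List.getD_cons_succ,
    List.getD_cons_zero]
  refine ⟨fun p => ?_, fun p hpu hpt => ?_⟩
  · rw [Function.update_of_ne (by omega), h1 p]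
  rcases Nat.lt_succ_iff_lt_or_eq.1 hpt with hpt | rfl
  · rw [Function.update_of_ne (by omega), h2 p hpu hpt]
  · rw [Function.update_self, add_assoc, h1, ← add_assoc, hnorm p hpu]

end RAM

theorem mainTheorem4 :
    RAM.SolvableInPolyTime encodeWordPair
      (fun x : List ℕ × List ℕ => x.1.length + x.2.length)
      (fun x : List ℕ × List ℕ => IsPerm231Avoiding x.1 ∧ IsPerm231Avoiding x.2)
      (fun (x : List ℕ × List ℕ) (u : List ℕ) => IsGreatestCommonPattern u x.1 x.2) := by
  refine RAM.solvableInPolyTime_of_cmd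
    (.add (.add (.load (.const 0)) (.load (.add (.load (.const 0)) (.const 1)))) (.const 2))
    .greatestCommonPattern (fun x => x.1.length + x.2.length + 2) (Polynomial.X + 2) ?_ ?_ ?_
  · rintro ⟨w, v⟩ -
    simp [RAM.Exp.eval, RAM.init, encodeWordPair]
  · rintro ⟨w, v⟩ -
    simp
  · rintro ⟨w, v⟩ ⟨hw, hv⟩ pc reg
    dsimp only
    rw [RAM.output_greatestCommonPattern hw.avoids231 hv.avoids231 rfl]
    exact isGreatestCommonPattern_commonSubword hw.avoids231 hv.avoids231
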